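/- Let $G=(V,E)$ be a finite, simple, undirected, connected unit interval graph, i.e. the vertices of $G$ can be represented by closed intervals of the real line, all of the same positive length, so that two distinct vertices are adjacent if and only if their intervals intersect. Put $n=|V|$. For $t\in V$ let $N(t)$ be the set of neighbours of $t$ and $N[t]=N(t)\cup\{t\}$; $t$ is simplicial if $N(t)$ is a clique, and $G-N[t]$ is the subgraph induced by $V\setminus N[t]$ (the graph without vertices counts as connected). A vertex ordering is a bijection $\sigma:V\to\{1,\dots,n\}$; it ends in $t$ if $\sigma(t)=n$. A unit interval order of $G$ is a vertex ordering $\sigma$ such that whenever $\sigma(u)<\sigma(v)<\sigma(w)$ and $uw\in E$, then $uv\in E$ and $vw\in E$. A graph search on $G$ chooses a start vertex $s\in V$ and numbers the vertices $1,\dots,n$ one after another; its output is the resulting vertex ordering. - Maximal Neighborhood Search (MNS): initially $s$ has label $\{n+1\}$ and every other vertex has label $\emptyset$. For $i=1,\dots,n$, give the number $i$ to an unnumbered vertex whose label is inclusion-maximal among the labels of the unnumbered vertices, then add $i$ to the label of each of its unnumbered neighbours. - Maximum Cardinality Search (MCS): the vertex $s$ gets number $1$. For $i=2,\dots,n$,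 give the number $i$ to an unnumbered vertex with the largest number of numbered neighbours. - Lexicographic Depth First Search (LDFS): initially $s$ has as label the sequence $(0)$ and every other vertex has the empty sequence. For $i=1,\dots,n$, give the number $i$ to an unnumbered vertex whose label is lexicographically largest (a proper prefix of a sequence being smaller than the sequence), then prepend $i$ to the label of each of its unnumbered neighbours. A vertex $t$ is an end-vertex of MNS (of MCS, of LDFS) if, for some $s$ and some choices made by the search, the output ends in $t$. Theorem. For every vertex $t$ of $G$ the following five statements are equivalent: (i) $t$ is simplicial and $G-N[t]$ is connected; (ii) some unit interval order of $G$ ends in $t$; (iii) $t$ is an end-vertex of MNS; (iii') $t$ is an end-vertex of MCS; (iii'') $t$ is an end-vertex of LDFS. In particular, MNS, MCS and LDFS have the same set of end-vertices on $G$. -/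

import Mathlib

namespace GraphSearch

variable {V : Type*}

/-- `G` is a unit interval graph: its vertices can be represented by closed real intervals
`[l v, r v]`, all of the same length, so that two distinct vertices are adjacent if and only if
their intervals intersect. -/
def IsUnitIntervalGraph (G : SimpleGraph V) : Prop :=
  ∃ (l r : V → ℝ) (len : ℝ), 0 < len ∧ (∀ v, r v - l v = len) ∧
    ∀ u v, u ≠ v → (G.Adj u v ↔ (Set.Icc (l u) (r u) ∩ Set.Icc (l v) (r v)).Nonempty)

/-- The closed neighbourhood `N[t]`. -/
def closedNeighborSet (G : SimpleGraph V) (t : V) : Set V :=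
  insert t (G.neighborSet t)

/-- A vertex is simplicial if its neighbourhood is a clique. -/
def IsSimplicial (G : SimpleGraph V) (t : V) : Prop :=
  G.IsClique (G.neighborSet t)

/-- The graph `G - S` induced by the vertices outside `S`. -/
abbrev deleteSet (G : SimpleGraph V) (S : Set V) : SimpleGraph ↥(Sᶜ) :=
  G.induce Sᶜ

/-- A vertex ordering: a bijection onto the positions. Positions are counted from `0`, so the
vertex `v` is the vertex with number `(σ v : ℕ) + 1` among `1, …, n`. -/
abbrev Ordering (V : Type*) [Fintype V] : Type _ :=
  V ≃ Fin (Fintype.card V)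

variable [Fintype V]

/-- The number in `{1, …, n}` that the ordering gives to `v`. -/
def number (σ : Ordering V) (v : V) : ℕ := (σ v : ℕ) + 1

/-- `t` is the last vertex (the end-vertex) of `σ`. -/
def IsLast (σ : Ordering V) (t : V) : Prop :=
  number σ t = Fintype.card V

/-- Whenever `u`, `v`, `w` occur in this order and `uw` is an edge, `uv` and `vw` are edges. -/
def IsUnitIntervalOrder (G : SimpleGraph V) (σ : Ordering V) : Prop :=
  ∀ u v w, σ u < σ v → σ v < σ w → G.Adj u w → G.Adj u v ∧ G.Adj v w

open Classical in
/-- Labels of Maximal Neighborhood Search from `s`, after `i` vertices have been numbered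
according to `σ`. Initially `s` has label `{n + 1}` and the other labels are empty; when a vertex
gets number `i`, then `i` is added to the label of each of its unnumbered neighbours. -/
noncomputable def mnsLabel (G : SimpleGraph V) (s : V) (σ : Ordering V) : ℕ → V → Finset ℕ
  | 0, w => if w = s then {Fintype.card V + 1} else ∅
  | i + 1, w =>
      if i + 1 < number σ w ∧ ∃ v, number σ v = i + 1 ∧ G.Adj v w then
        insert (i + 1) (mnsLabel G s σ i w)
      else mnsLabel G s σ i w

/-- `σ` is an output of Maximal Neighborhood Search started at `s`: each vertex `v`, at the moment
when it is chosen (after `σ v` vertices have been numbered), has an inclusion-maximal label among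
the unnumbered vertices. -/
def IsMNSOrdering (G : SimpleGraph V) (s : V) (σ : Ordering V) : Prop :=
  ∀ v w, σ v ≤ σ w → ¬ mnsLabel G s σ (σ v) v ⊂ mnsLabel G s σ (σ v) w

/-- The number of neighbours of `w` among the first `i` vertices of `σ`. -/
noncomputable def numberedNeighbors (G : SimpleGraph V) (σ : Ordering V) (i : ℕ) (w : V) : ℕ :=
  {u : V | number σ u ≤ i ∧ G.Adj u w}.ncard

/-- `σ` is an output of Maximum Cardinality Search started at `s`: the first vertex is `s`, and each
later vertex, at the moment when it is chosen, has the largest number of numbered neighbours among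
the unnumbered vertices. -/
def IsMCSOrdering (G : SimpleGraph V) (s : V) (σ : Ordering V) : Prop :=
  number σ s = 1 ∧
    ∀ v w, 2 ≤ number σ v → σ v ≤ σ w →
      numberedNeighbors G σ (σ v) w ≤ numberedNeighbors G σ (σ v) v

open Classical in
/-- Labels of Lexicographic Depth First Search from `s`, after `i` vertices have been numbered
according to `σ`. Initially `s` has label `(0)` and the other labels are empty; when a vertex gets
number `i`, then `i` is prepended to the label of each of its unnumbered neighbours. -/
noncomputable def ldfsLabel (G : SimpleGraph V) (s : V) (σ : Ordering V) : ℕ → V → List ℕ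
  | 0, w => if w = s then [0] else []
  | i + 1, w =>
      if i + 1 < number σ w ∧ ∃ v, number σ v = i + 1 ∧ G.Adj v w then
        (i + 1) :: ldfsLabel G s σ i w
      else ldfsLabel G s σ i w

/-- `σ` is an output of Lexicographic Depth First Search started at `s`: each vertex, at the moment
when it is chosen, has a lexicographically largest label among the unnumbered vertices.
(The order on `List ℕ` is lexicographic; a proper prefix is smaller.) -/
def IsLDFSOrdering (G : SimpleGraph V) (s : V) (σ : Ordering V) : Prop :=
  ∀ v w, σ v ≤ σ w → ldfsLabel G s σ (σ v) w ≤ ldfsLabel G s σ (σ v) v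

/-- `t` is the last vertex of some MNS ordering of `G`. -/
def IsMNSEndVertex (G : SimpleGraph V) (t : V) : Prop :=
  ∃ (s : V) (σ : Ordering V), IsMNSOrdering G s σ ∧ IsLast σ t

/-- `t` is the last vertex of some MCS ordering of `G`. -/
def IsMCSEndVertex (G : SimpleGraph V) (t : V) : Prop :=
  ∃ (s : V) (σ : Ordering V), IsMCSOrdering G s σ ∧ IsLast σ t

/-- `t` is the last vertex of some LDFS ordering of `G`. -/
def IsLDFSEndVertex (G : SimpleGraph V) (t : V) : Prop :=
  ∃ (s : V) (σ : Ordering V), IsLDFSOrdering G s σ ∧ IsLast σ t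

end GraphSearch

/-! A unit interval representation, read from left to right, gives a ranking `p` in which every edge
forms a triangle with each vertex under it. Ranks are integers, so that `-p` is the reversed
ranking. All statements are compared with one condition: `t` is an initial twin for `p` or for `-p`.
It is equivalent to (i), because `G - N[t]` is connected only if the non-neighbours of `t` lie on
one side of it. It gives (ii), because an initial twin can be moved to the end of the reversed
ranking. Along a unit interval order the earlier neighbourhoods of the unnumbered vertices are
nested, so all three searches can follow it.

For the converse, only the property `IsNeighborhoodMaximal`, common to the three searches, is
needed. If `t` is last but not an initial twin on either side, it has extreme neighbours `l` and `r`
on its two sides, and these are adjacent (`adj_of_chosen_before`). There are also a vertex `z` on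
the side of `l` not adjacent to `r` and a vertex `w` on the side of `r` not adjacent to `l`. Taking
the first chosen of each kind, `false_of_chosen_before` and its mirror image forbid either to
precede the other. -/

namespace GraphSearch

/-! ### Umbrella rankings and condition (i) -/

section UmbrellaRank

variable {V : Type*}

/-- An injective ranking of the vertices such that every edge `uw` forms a triangle with each
vertex ranked between `u` and `w`. -/
structure IsUmbrellaRank (G : SimpleGraph V) (p : V → ℤ) : Prop where
  injective : Function.Injective p
  adj_of_lt : ∀ {u v w}, p u < p v → p v < p w → G.Adj u w → G.Adj u v ∧ G.Adj v w

theorem IsUmbrellaRank.neg {G : SimpleGraph V} {p : V → ℤ} (hp : IsUmbrellaRank G p) :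
    IsUmbrellaRank G (fun v => -p v) where
  injective _ _ h := hp.injective (neg_injective h)
  adj_of_lt h₁ h₂ h :=
    have := hp.adj_of_lt (neg_lt_neg_iff.mp h₂) (neg_lt_neg_iff.mp h₁) h.symm
    ⟨this.2.symm, this.1.symm⟩

/-- Every vertex ranked before `t` is adjacent to `t` and to all neighbours of `t` ranked
after `t`. -/
def IsInitialTwin (G : SimpleGraph V) (p : V → ℤ) (t : V) : Prop :=
  ∀ w, p w < p t → G.Adj w t ∧ ∀ c, p t < p c → G.Adj t c → G.Adj w c

theorem exists_adj_of_mem_of_notMem {G : SimpleGraph V} (hconn : G.Connected) (S : Set V)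
    {a b : V} (ha : a ∈ S) (hb : b ∉ S) : ∃ u ∈ S, ∃ w ∉ S, G.Adj u w := by
  obtain ⟨q⟩ := hconn.preconnected a b
  induction q with
  | nil => exact absurd ha hb
  | @cons u v w h q ih =>
    by_cases hv : v ∈ S
    · exact ih hv hb
    · exact ⟨u, ha, v, hv, h⟩

/-- By connectedness some edge leaves the set of ranks up to that of `v`. It starts at `v` or passes
over `v`, and in both cases its upper end is adjacent to `v`. -/
theorem IsUmbrellaRank.exists_adj_gt {G : SimpleGraph V} {p : V → ℤ} (hp : IsUmbrellaRank G p)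
    (hconn : G.Connected) {v w : V} (hvw : p v < p w) : ∃ u, p v < p u ∧ G.Adj v u := by
  obtain ⟨a, ha, b, hb, hab⟩ :=
    exists_adj_of_mem_of_notMem hconn {u | p u ≤ p v} (a := v) (b := w) (le_refl (p v))
      (not_le.mpr hvw)
  simp only [Set.mem_ofPred_eq, not_le] at ha hb
  rcases ha.lt_or_eq with h | h
  · exact ⟨b, hb, (hp.adj_of_lt h hb hab).2⟩
  · exact ⟨b, hb, hp.injective h ▸ hab⟩

theorem IsUmbrellaRank.isSimplicial_and_preconnected [Finite V] {G : SimpleGraph V} {p : V → ℤ}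
    (hp : IsUmbrellaRank G p) (hconn : G.Connected) {t : V} (ht : IsInitialTwin G p t) :
    IsSimplicial G t ∧ (deleteSet G (closedNeighborSet G t)).Preconnected := by
  constructor
  · have key : ∀ a b, p a < p b → G.Adj t a → G.Adj t b → G.Adj a b := by
      intro a b hab ha hb
      have hat : p a ≠ p t := fun h => ha.ne (hp.injective h).symm
      have hbt : p b ≠ p t := fun h => hb.ne (hp.injective h).symm
      rcases lt_or_gt_of_ne hat with h₁ | h₁
      · rcases lt_or_gt_of_ne hbt with h₂ | h₂
        · exact (hp.adj_of_lt hab h₂ ha.symm).1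
        · exact (ht a h₁).2 b h₂ hb
      · exact (hp.adj_of_lt h₁ hab hb).2
    intro a ha b hb hne
    rcases lt_or_gt_of_ne (hp.injective.ne hne) with h | h
    · exact key a b h ha hb
    · exact (key b a h hb ha).symm
  · have hmem : ∀ v, v ∈ (closedNeighborSet G t)ᶜ ↔ p t < p v ∧ ¬ G.Adj t v := by
      intro v
      simp only [closedNeighborSet, Set.mem_compl_iff, Set.mem_insert_iff,
        SimpleGraph.mem_neighborSet, not_or]
      constructor
      · rintro ⟨h₁, h₂⟩
        refine ⟨?_, h₂⟩
        rcases lt_or_gt_of_ne (hp.injective.ne h₁) with h | h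
        · exact absurd (ht v h).1.symm h₂
        · exact h
      · rintro ⟨h₁, h₂⟩
        exact ⟨fun h => by simp [h] at h₁, h₂⟩
    intro a b
    have := Fintype.ofFinite V
    classical
    -- Every vertex of `G - N[t]` climbs to the highest one, `M`; a highest vertex that fails to
    -- reach `M` would have a higher neighbour that succeeds.
    obtain ⟨M, -, hM⟩ := Finset.exists_max_image (Finset.univ : Finset ↥(closedNeighborSet G t)ᶜ)
      (fun v => p v) ⟨a, Finset.mem_univ a⟩
    have reach : ∀ v, (deleteSet G (closedNeighborSet G t)).Reachable v M := by
      by_contra! hcon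
      obtain ⟨v, hv, hvmax⟩ := Finset.exists_max_image
        (Finset.univ.filter fun v => ¬ (deleteSet G (closedNeighborSet G t)).Reachable v M)
        (fun v => p v) (by obtain ⟨v, hv⟩ := hcon; exact ⟨v, by simpa using hv⟩)
      simp only [Finset.mem_filter, Finset.mem_univ, true_and] at hv hvmax
      have hlt : p v < p M := by
        refine lt_of_le_of_ne (hM v (Finset.mem_univ v)) fun h => hv ?_
        rw [Subtype.ext (hp.injective h)]
      obtain ⟨u, hu, hvu⟩ := hp.exists_adj_gt hconn hlt
      have hv' := (hmem v).1 v.2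
      -- Climbing stays outside `N[t]`: an edge from `t` to `u` would pass over `v` and make `v` a
      -- neighbour of `t`.
      have hu' : u ∈ (closedNeighborSet G t)ᶜ :=
        (hmem u).2 ⟨hv'.1.trans hu, fun h => hv'.2 (hp.adj_of_lt hv'.1 hu h).1⟩
      have hadj : (deleteSet G (closedNeighborSet G t)).Adj v ⟨u, hu'⟩ := hvu
      have hur : (deleteSet G (closedNeighborSet G t)).Reachable ⟨u, hu'⟩ M := by
        by_contra h
        exact absurd (hvmax ⟨u, hu'⟩ h) (not_le.mpr hu)
      exact hv (hadj.reachable.trans hur)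
    exact (reach a).trans (reach b).symm

/-- An edge passing over `t` has both ends in `N(t)`, so no path in `G - N[t]` changes sides. On a
side without non-neighbours, simpliciality supplies the other half of the twin condition. -/
theorem IsUmbrellaRank.isInitialTwin_or {G : SimpleGraph V} {p : V → ℤ}
    (hp : IsUmbrellaRank G p) {t : V} (hs : IsSimplicial G t)
    (hc : (deleteSet G (closedNeighborSet G t)).Preconnected) :
    IsInitialTwin G p t ∨ IsInitialTwin G (fun v => -p v) t := by
  have hside : (∀ w, p w < p t → G.Adj w t) ∨ (∀ w, p t < p w → G.Adj w t) := by
    by_contra! h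
    obtain ⟨⟨a, hat, ha⟩, b, htb, hb⟩ := h
    have hmem : ∀ v, p v ≠ p t → ¬ G.Adj v t → v ∈ (closedNeighborSet G t)ᶜ := by
      intro v h₁ h₂
      simp only [closedNeighborSet, Set.mem_compl_iff, Set.mem_insert_iff,
        SimpleGraph.mem_neighborSet, not_or]
      exact ⟨fun h => h₁ (h ▸ rfl), fun h => h₂ h.symm⟩
    have step : ∀ u v : ↥(closedNeighborSet G t)ᶜ,
        (deleteSet G (closedNeighborSet G t)).Walk u v → p u < p t → p v < p t := by
      intro u v q
      induction q with
      | nil => exact id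
      | @cons u v w h q ih =>
        intro hu
        apply ih
        have hv := v.2
        simp only [closedNeighborSet, Set.mem_compl_iff, Set.mem_insert_iff,
          SimpleGraph.mem_neighborSet, not_or] at hv
        by_contra hlt
        have hlt' : p t < p v :=
          lt_of_le_of_ne (not_lt.mp hlt) fun h => hv.1 (hp.injective h).symm
        exact hv.2 (hp.adj_of_lt hu hlt' h).2
    obtain ⟨q⟩ := hc ⟨a, hmem a hat.ne ha⟩ ⟨b, hmem b htb.ne' hb⟩
    exact absurd (step _ _ q hat) (not_lt.mpr htb.le)
  rcases hside with h | h
  · exact Or.inl fun w hw => ⟨h w hw, fun c hc htc =>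
      hs (h w hw).symm htc fun e => by subst e; exact absurd hw (not_lt.mpr hc.le)⟩
  · refine Or.inr fun w hw => ?_
    have hw := neg_lt_neg_iff.mp hw
    exact ⟨h w hw, fun c hc htc => hs (h w hw).symm htc fun e => by
      subst e; exact absurd hw (not_lt.mpr (neg_lt_neg_iff.mp hc).le)⟩

theorem IsUmbrellaRank.exists_not_adj {G : SimpleGraph V} {p : V → ℤ}
    (hp : IsUmbrellaRank G p) {t r : V} (ht : ¬ IsInitialTwin G p t)
    (hrt : p t < p r) (hrmax : ∀ v, G.Adj t v → p v ≤ p r) :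
    ∃ z, p z < p t ∧ ¬ G.Adj z r := by
  by_contra! h
  refine ht fun w hw => ⟨(hp.adj_of_lt hw hrt (h w hw)).1, fun c hc htc => ?_⟩
  rcases (hrmax c htc).lt_or_eq with h' | h'
  · exact (hp.adj_of_lt (hw.trans hc) h' (h w hw)).1
  · exact hp.injective h' ▸ h w hw

end UmbrellaRank

/-! ### Orderings from intervals and from initial twins -/

section Orderings

variable {V : Type*} [Fintype V]

theorem exists_ordering_lt_iff {α : Type*} [LinearOrder α] (f : V → α)
    (hf : Function.Injective f) : ∃ σ : Ordering V, ∀ u v, σ u < σ v ↔ f u < f v := by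
  classical
  have hcard : (Finset.univ.image f).card = Fintype.card V := by
    rw [Finset.card_image_of_injective _ hf, Finset.card_univ]
  let e : V ≃ ↥(Finset.univ.image f) := Equiv.ofBijective
    (fun v => ⟨f v, Finset.mem_image_of_mem f (Finset.mem_univ v)⟩)
    ⟨fun _ _ h => hf (congrArg Subtype.val h), fun ⟨y, hy⟩ => by
      obtain ⟨v, -, rfl⟩ := Finset.mem_image.mp hy
      exact ⟨v, rfl⟩⟩
  refine ⟨e.trans ((Finset.univ.image f).orderIsoOfFin hcard).symm.toEquiv, fun u v => ?_⟩
  exact ((Finset.univ.image f).orderIsoOfFin hcard).symm.lt_iff_lt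

theorem isLast_iff {σ : Ordering V} {t : V} : IsLast σ t ↔ ∀ v, σ v ≤ σ t := by
  unfold IsLast number
  constructor
  · intro h v
    have := (σ v).isLt
    rw [Fin.le_def]
    omega
  · intro h
    have ht := (σ t).isLt
    have := h (σ.symm ⟨Fintype.card V - 1, by omega⟩)
    rw [Equiv.apply_symm_apply, Fin.le_def] at this
    simp only at this
    omega

theorem IsUnitIntervalGraph.exists_isUmbrellaRank {G : SimpleGraph V}
    (hG : IsUnitIntervalGraph G) : ∃ p : V → ℤ, IsUmbrellaRank G p := by
  obtain ⟨l, r, len, hlen, hlr, hadj⟩ := hG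
  have hadj' : ∀ u v, l u ≤ l v → u ≠ v → (G.Adj u v ↔ l v ≤ l u + len) := by
    intro u v huv hne
    rw [hadj u v hne]
    have := hlr u
    have := hlr v
    constructor
    · rintro ⟨x, ⟨h₁, h₂⟩, h₃, h₄⟩
      linarith
    · intro h
      exact ⟨l v, ⟨huv, by linarith⟩, le_rfl, by linarith⟩
  -- Sort by left endpoints; the second coordinate breaks ties between equal intervals.
  obtain ⟨σ, hσ⟩ := exists_ordering_lt_iff
    (fun v => toLex (l v, Fintype.equivFin V v)) fun u v h => by
      simpa using (Prod.ext_iff.mp (toLex.injective h)).2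
  have hle : ∀ u v, σ u < σ v → l u ≤ l v := by
    intro u v h
    rcases (Prod.Lex.lt_iff).mp ((hσ u v).mp h) with h | h
    · exact h.le
    · exact h.1.le
  refine ⟨fun v => ((σ v : ℕ) : ℤ), fun u v h => ?_, fun {u v w} huv hvw huw => ?_⟩
  · exact σ.injective (Fin.ext (by exact_mod_cast h))
  · have huv : σ u < σ v := by rw [Fin.lt_def]; exact_mod_cast huv
    have hvw : σ v < σ w := by rw [Fin.lt_def]; exact_mod_cast hvw
    have h₁ := hle u v huv
    have h₂ := hle v w hvw
    have h₃ := (hadj' u w (h₁.trans h₂) huw.ne).mp huw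
    exact ⟨(hadj' u v h₁ fun h => huv.ne (h ▸ rfl)).mpr (by linarith),
      (hadj' v w h₂ fun h => hvw.ne (h ▸ rfl)).mpr (by linarith)⟩

theorem IsUmbrellaRank.exists_isUnitIntervalOrder {G : SimpleGraph V} {p : V → ℤ}
    (hp : IsUmbrellaRank G p) {t : V} (ht : IsInitialTwin G p t) :
    ∃ σ : Ordering V, IsUnitIntervalOrder G σ ∧ IsLast σ t := by
  classical
  -- The first coordinate sends `t` to the end, the second reverses the ranking of the others.
  obtain ⟨σ, hσ⟩ := exists_ordering_lt_iff
    (fun v => toLex ((if v = t then 1 else 0 : ℕ), -p v)) fun u v h => by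
      simpa [hp.injective.eq_iff] using (Prod.ext_iff.mp (toLex.injective h)).2
  have hlast : ∀ v, ¬ σ t < σ v := by
    intro v
    rw [hσ, Prod.Lex.lt_iff]
    by_cases h : v = t <;> simp [h]
  have hlt : ∀ u v, v ≠ t → σ u < σ v → p v < p u := by
    intro u v hv h
    have hu : u ≠ t := fun e => hlast v (e ▸ h)
    rw [hσ, Prod.Lex.lt_iff] at h
    simpa [hv, hu] using h
  refine ⟨σ, fun u v w huv hvw huw => ?_, isLast_iff.mpr fun v => not_lt.mp (hlast v)⟩
  have hv : v ≠ t := fun e => hlast w (e ▸ hvw)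
  have h₁ := hlt u v hv huv
  by_cases hw : w = t
  · subst hw
    rcases lt_or_gt_of_ne (hp.injective.ne hv) with h | h
    · refine ⟨?_, (ht v h).1⟩
      rcases lt_or_gt_of_ne (hp.injective.ne huw.ne) with h' | h'
      · exact (hp.adj_of_lt h₁ h' (ht v h).1).1.symm
      · exact ((ht v h).2 u h' huw.symm).symm
    · have := hp.adj_of_lt h h₁ huw.symm
      exact ⟨this.2.symm, this.1.symm⟩
  · have := hp.adj_of_lt (hlt v w hw hvw) h₁ huw.symm
    exact ⟨this.2.symm, this.1.symm⟩

/-! ### Last vertices of neighbourhood-maximal orderings -/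

/-- Whenever `v` is chosen before `w` although an earlier neighbour `a` of `w` is not adjacent
to `v`, there is an earlier neighbour of `v` that is not adjacent to `w`. -/
def IsNeighborhoodMaximal (G : SimpleGraph V) (σ : Ordering V) : Prop :=
  ∀ a v w, σ a < σ v → σ v < σ w → G.Adj a w → ¬ G.Adj a v →
    ∃ b, σ b < σ v ∧ G.Adj b v ∧ ¬ G.Adj b w

/-- Some edge `aw` leaves the vertices chosen before `v`. If `a` is not adjacent to `v`, then `v`
was preferred to `w` because of another earlier neighbour. -/
theorem IsNeighborhoodMaximal.exists_earlier_adj {G : SimpleGraph V} {σ : Ordering V}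
    (hσ : IsNeighborhoodMaximal G σ) (hconn : G.Connected) {u v : V} (huv : σ u < σ v) :
    ∃ b, σ b < σ v ∧ G.Adj b v := by
  obtain ⟨a, ha, w, hw, haw⟩ :=
    exists_adj_of_mem_of_notMem hconn {u | σ u < σ v} (a := u) (b := v) huv
      (lt_irrefl (σ v))
  simp only [Set.mem_ofPred_eq, not_lt] at ha hw
  rcases hw.lt_or_eq with h | h
  · by_cases hav : G.Adj a v
    · exact ⟨a, ha, hav⟩
    · obtain ⟨b, hb, hbv, -⟩ := hσ a v w ha h haw hav
      exact ⟨b, hb, hbv⟩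
  · exact ⟨a, ha, σ.injective h ▸ haw⟩

/-- The vertices chosen before `z` cannot skip an unchosen rank without an edge across it. -/
theorem IsNeighborhoodMaximal.exists_adj_across {G : SimpleGraph V} {σ : Ordering V}
    (hσ : IsNeighborhoodMaximal G σ) (hconn : G.Connected) {p : V → ℤ} {m : ℤ} {a b z : V}
    (hm : ∀ v, σ v < σ z → p v ≠ m) (ha : σ a < σ z) (hb : σ b < σ z)
    (ham : p a < m) (hbm : m < p b) :
    ∃ u v, σ u < σ z ∧ σ v < σ z ∧ p u < m ∧ m < p v ∧ G.Adj u v := by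
  classical
  -- Take the first chosen vertex on each side of `m`. The later of the two has an earlier
  -- neighbour, which must lie on the opposite side.
  obtain ⟨a', ha', hamin⟩ := Finset.exists_min_image
    (Finset.univ.filter fun v => σ v < σ z ∧ p v < m) σ ⟨a, by simp [ha, ham]⟩
  obtain ⟨b', hb', hbmin⟩ := Finset.exists_min_image
    (Finset.univ.filter fun v => σ v < σ z ∧ m < p v) σ ⟨b, by simp [hb, hbm]⟩
  simp only [Finset.mem_filter, Finset.mem_univ, true_and] at ha' hamin hb' hbmin
  have hne : σ a' ≠ σ b' := fun h => by
    have := σ.injective h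
    subst this
    exact absurd ha'.2 (not_lt.mpr hb'.2.le)
  rcases lt_or_gt_of_ne hne with h | h
  · obtain ⟨c, hc, hcb⟩ := hσ.exists_earlier_adj hconn h
    have hcz := hc.trans hb'.1
    refine ⟨c, b', hcz, hb'.1, ?_, hb'.2, hcb⟩
    rcases lt_or_gt_of_ne (hm c hcz) with h' | h'
    · exact h'
    · exact absurd hc (not_lt.mpr (hbmin c ⟨hcz, h'⟩))
  · obtain ⟨c, hc, hca⟩ := hσ.exists_earlier_adj hconn h
    have hcz := hc.trans ha'.1
    refine ⟨a', c, ha'.1, hcz, ha'.2, ?_, hca.symm⟩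
    rcases lt_or_gt_of_ne (hm c hcz) with h' | h'
    · exact absurd hc (not_lt.mpr (hamin c ⟨hcz, h'⟩))
    · exact h'

/-- If adjacent vertices `l` and `r` lie on different sides of a last vertex `t`, a vertex beyond `t` not adjacent
to `l` cannot be chosen before all vertices `z` on the other side of `t` not adjacent to `r`. -/
theorem IsNeighborhoodMaximal.false_of_chosen_before {G : SimpleGraph V} {σ : Ordering V}
    (hσ : IsNeighborhoodMaximal G σ) (hconn : G.Connected) {p : V → ℤ}
    (hp : IsUmbrellaRank G p) {t l r z w : V} (ht : ∀ v, v ≠ t → σ v < σ t)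
    (hlr : G.Adj l r) (hlt : p l < p t) (hrt : p t < p r) (htr : G.Adj t r)
    (hzt : p z < p t) (hzr : ¬ G.Adj z r)
    (hzmin : ∀ v, σ v < σ z → p v < p t → G.Adj v r)
    (hwt : p t < p w) (hwl : ¬ G.Adj l w) (hwz : σ w < σ z) : False := by
  have hzσ : σ z < σ t := ht z fun h => by simp [h] at hzt
  have hpne : ∀ v, σ v < σ z → p v ≠ p t := fun v hv h => by
    rw [hp.injective h] at hv
    exact absurd hv (not_lt.mpr hzσ.le)
  have hz_gt : ∀ v, G.Adj z v → ¬ p r ≤ p v := by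
    intro v hzv h
    rcases h.lt_or_eq with h | h
    · exact hzr (hp.adj_of_lt (hzt.trans hrt) h hzv).1
    · exact hzr (hp.injective h ▸ hzv)
  -- If `r` came first, `z` could be preferred to `t` only for a neighbour not adjacent to `t`, but
  -- all earlier neighbours of `z` are adjacent to `t`.
  have hrz : σ z < σ r := by
    rcases lt_trichotomy (σ z) (σ r) with h | h | h
    · exact h
    · rw [σ.injective h] at hzt
      exact absurd hzt (not_lt.mpr hrt.le)
    · obtain ⟨b, hb, hbz, hbt⟩ := hσ r z t h hzσ htr.symm fun h' => hzr h'.symm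
      rcases lt_or_gt_of_ne (hpne b hb) with h' | h'
      · exact absurd (hp.adj_of_lt h' hrt (hzmin b hb h')).1 hbt
      · exact absurd (hp.adj_of_lt hzt h' hbz.symm).2.symm hbt
  have hadjr : ∀ b, σ b < σ z → p b < p r → G.Adj b r := by
    intro b hb hbr
    rcases lt_or_gt_of_ne (hpne b hb) with h | h
    · exact hzmin b hb h
    · exact (hp.adj_of_lt h hbr htr).2
  -- As `z` was preferred to `r` and has no earlier neighbour outside `N(r)`, it must see all
  -- earlier neighbours of `r`.
  have hsub : ∀ a, σ a < σ z → G.Adj a r → G.Adj a z := by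
    intro a ha har
    by_contra haz
    obtain ⟨b, hb, hbz, hbr⟩ := hσ a z r ha hrz har haz
    exact hbr (hadjr b hb (not_le.mp (hz_gt b hbz.symm)))
  have hwr : p w ≠ p r := fun h => by
    rw [hp.injective h] at hwz
    exact absurd hwz (not_lt.mpr hrz.le)
  rcases lt_or_gt_of_ne hwr with h | h
  · exact hwl (hp.adj_of_lt (hlt.trans hwt) h hlr).1
  -- Here `w` lies beyond `r`, while `z` has an earlier neighbour below `r`. An earlier edge across
  -- `r` then gives a neighbour of `r`, hence of `z`, beyond `r`.
  · obtain ⟨b, hb, hbz⟩ := hσ.exists_earlier_adj hconn hwz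
    obtain ⟨u, v, hu, hv, hur, hrv, huv⟩ := hσ.exists_adj_across hconn (p := p) (m := p r)
      (fun v hv h => by
        rw [hp.injective h] at hv
        exact absurd hv (not_lt.mpr hrz.le)) hb hwz (not_le.mp (hz_gt b hbz.symm)) h
    have := hsub v hv (hp.adj_of_lt hur hrv huv).2.symm
    exact hz_gt v this.symm hrv.le

/-- If `t` is last, its lowest ranked neighbour `l` is adjacent to every neighbour `r` of `t` on the
other side that is chosen before `l`. -/
theorem IsNeighborhoodMaximal.adj_of_chosen_before {G : SimpleGraph V} {σ : Ordering V}
    (hσ : IsNeighborhoodMaximal G σ) (hconn : G.Connected) {p : V → ℤ}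
    (hp : IsUmbrellaRank G p) {t l r : V} (ht : ∀ v, v ≠ t → σ v < σ t)
    (htl : G.Adj t l) (hlt : p l < p t) (hlmin : ∀ v, G.Adj t v → p l ≤ p v)
    (htr : G.Adj t r) (hrt : p t < p r) (hrl : σ r < σ l) : G.Adj l r := by
  classical
  by_contra hlr
  have hlσ : σ l < σ t := ht l fun h => by simp [h] at hlt
  have hpl : ∀ v, σ v < σ l → p v ≠ p l := fun v hv h => by
    rw [hp.injective h] at hv
    exact lt_irrefl _ hv
  have hpt : ∀ v, σ v < σ l → p v ≠ p t := fun v hv h => by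
    rw [hp.injective h] at hv
    exact lt_asymm hv hlσ
  have hfar : ∀ u v, p u < p l → G.Adj u v → p v < p t := by
    intro u v hu huv
    by_contra h
    rcases (not_lt.mp h).lt_or_eq with h' | h'
    · exact absurd (hlmin u (hp.adj_of_lt (hu.trans hlt) h' huv).1.symm) (not_le.mpr hu)
    · rw [← hp.injective h'] at huv
      exact absurd (hlmin u huv.symm) (not_le.mpr hu)
  -- `l` was preferred to `t` although only `t` sees `r`; the compensating neighbour of `l` must lie
  -- below `l`.
  obtain ⟨y₀, hy₀, hy₀l, hy₀t⟩ := hσ r l t hrl hlσ htr.symm fun h => hlr h.symm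
  have hy₀lt : p y₀ < p l := by
    rcases lt_or_gt_of_ne (hpl y₀ hy₀) with h | h
    · exact h
    · rcases lt_or_gt_of_ne (hpt y₀ hy₀) with h' | h'
      · exact absurd (hp.adj_of_lt h h' htl.symm).2 hy₀t
      · exact absurd (hp.adj_of_lt hlt h' hy₀l.symm).2.symm hy₀t
  obtain ⟨y, hy, hymin⟩ := Finset.exists_min_image
    (Finset.univ.filter fun v => σ v < σ l ∧ p v < p l) σ ⟨y₀, by simp [hy₀, hy₀lt]⟩
  obtain ⟨q, hq, hqmin⟩ := Finset.exists_min_image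
    (Finset.univ.filter fun v => σ v < σ l ∧ p t < p v) σ ⟨r, by simp [hrl, hrt]⟩
  simp only [Finset.mem_filter, Finset.mem_univ, true_and] at hy hymin hq hqmin
  have hbelow : ∀ v, σ v < σ q → p v < p t := fun v hv =>
    (lt_or_gt_of_ne (hpt v (hv.trans hq.1))).resolve_right fun h =>
      absurd hv (not_lt.mpr (hqmin v ⟨hv.trans hq.1, h⟩))
  have habove : ∀ v, σ v < σ y → p l < p v := fun v hv =>
    (lt_or_gt_of_ne (hpl v (hv.trans hy.1))).resolve_left fun h =>
      absurd hv (not_lt.mpr (hymin v ⟨hv.trans hy.1, h⟩))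
  have hne : σ y ≠ σ q := fun h => by
    rw [σ.injective h] at hy
    exact lt_asymm (hy.2.trans hlt) hq.2
  rcases lt_or_gt_of_ne hne with h | h
  -- `y` precedes `q`: an edge across `l` gives `l` an earlier neighbour that `q` lacks, yet all
  -- earlier neighbours of `q` lie between `l` and `t` and see `l`.
  · have hgt : ∀ b, σ b < σ q → G.Adj b q → p l < p b := fun b hb hbq =>
      (hlmin b (hp.adj_of_lt (hbelow b hb) hq.2 hbq).1.symm).lt_of_ne (hpl b (hb.trans hq.1)).symm
    obtain ⟨b, hb, hbq⟩ := hσ.exists_earlier_adj hconn h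
    obtain ⟨u, v, hu, -, hul, hlv, huv⟩ := hσ.exists_adj_across hconn
      (fun v hv => hpl v (hv.trans hq.1)) h hb hy.2 (hgt b hb hbq)
    obtain ⟨c, hc, hcq, hcl⟩ := hσ u q l hu hq.1 (hp.adj_of_lt hul hlv huv).1
      fun huq => lt_asymm (hfar u q hul huq) hq.2
    exact hcl (hp.adj_of_lt (hgt c hc hcq) (hbelow c hc) htl.symm).1.symm
  -- `q` precedes `y`: the same argument with an edge across `t`, comparing `y` with `t`.
  · obtain ⟨b, hb, hby⟩ := hσ.exists_earlier_adj hconn h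
    obtain ⟨u, v, -, hv, hut, htv, huv⟩ := hσ.exists_adj_across hconn
      (fun v hv => hpt v (hv.trans hy.1)) hb h (hfar y b hy.2 hby.symm) hq.2
    obtain ⟨c, hc, hcy, hct⟩ := hσ v y t hv (hy.1.trans hlσ) (hp.adj_of_lt hut htv huv).2.symm
      fun hvy => lt_asymm (hfar y v hy.2 hvy.symm) htv
    exact hct (hp.adj_of_lt (habove c hc) (hfar y c hy.2 hcy.symm) htl.symm).2

theorem IsUmbrellaRank.exists_extreme_adj {G : SimpleGraph V} {p : V → ℤ}
    (hp : IsUmbrellaRank G p) (hconn : G.Connected) {t : V}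
    (ht : ¬ IsInitialTwin G (fun v => -p v) t) :
    ∃ r, G.Adj t r ∧ p t < p r ∧ ∀ v, G.Adj t v → p v ≤ p r := by
  classical
  unfold IsInitialTwin at ht
  push Not at ht
  obtain ⟨w, hw, -⟩ := ht
  obtain ⟨u, htu, hadj⟩ := hp.exists_adj_gt hconn (neg_lt_neg_iff.mp hw)
  obtain ⟨r, hr, hrmax⟩ := Finset.exists_max_image
    (Finset.univ.filter fun v => G.Adj t v) p ⟨u, by simp [hadj]⟩
  simp only [Finset.mem_filter, Finset.mem_univ, true_and] at hr hrmax
  exact ⟨r, hr, htu.trans_le (hrmax u hadj), hrmax⟩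

theorem IsNeighborhoodMaximal.isInitialTwin_or {G : SimpleGraph V} {σ : Ordering V}
    (hσ : IsNeighborhoodMaximal G σ) (hconn : G.Connected) {p : V → ℤ}
    (hp : IsUmbrellaRank G p) {t : V} (hlast : IsLast σ t) :
    IsInitialTwin G p t ∨ IsInitialTwin G (fun v => -p v) t := by
  classical
  by_contra! h
  have ht : ∀ v, v ≠ t → σ v < σ t := fun v hv =>
    (isLast_iff.mp hlast v).lt_of_ne (σ.injective.ne hv)
  have hL : ¬ IsInitialTwin G (fun v => - -p v) t := by simpa using h.1
  obtain ⟨r, htr, hrt, hrmax⟩ := hp.exists_extreme_adj hconn h.2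
  obtain ⟨l, htl, hlt, hlmin⟩ := hp.neg.exists_extreme_adj hconn hL
  have hlr : G.Adj l r := by
    have hne : σ l ≠ σ r := fun e => by
      rw [σ.injective e] at hlt
      exact lt_asymm hrt (neg_lt_neg_iff.mp hlt)
    rcases lt_or_gt_of_ne hne with h' | h'
    · exact (hσ.adj_of_chosen_before hconn hp.neg ht htr (neg_lt_neg hrt)
        (fun v hv => neg_le_neg (hrmax v hv)) htl hlt h').symm
    · exact hσ.adj_of_chosen_before hconn hp ht htl (neg_lt_neg_iff.mp hlt)
        (fun v hv => neg_le_neg_iff.mp (hlmin v hv)) htr hrt h'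
  obtain ⟨z₀, hz₀⟩ := hp.exists_not_adj h.1 hrt hrmax
  obtain ⟨w₀, hw₀⟩ := hp.neg.exists_not_adj h.2 hlt hlmin
  obtain ⟨z, hz, hzmin⟩ := Finset.exists_min_image
    (Finset.univ.filter fun v => p v < p t ∧ ¬ G.Adj v r) σ ⟨z₀, by simpa using hz₀⟩
  obtain ⟨w, hw, hwmin⟩ := Finset.exists_min_image
    (Finset.univ.filter fun v => -p v < -p t ∧ ¬ G.Adj v l) σ ⟨w₀, by simpa using hw₀⟩
  simp only [Finset.mem_filter, Finset.mem_univ, true_and] at hz hzmin hw hwmin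
  have hne : σ w ≠ σ z := fun e => by
    rw [σ.injective e] at hw
    exact lt_asymm hz.1 (neg_lt_neg_iff.mp hw.1)
  rcases lt_or_gt_of_ne hne with h' | h'
  · exact hσ.false_of_chosen_before hconn hp ht hlr (neg_lt_neg_iff.mp hlt) hrt htr hz.1 hz.2
      (fun v hv hvt => by_contra fun hvr => absurd hv (not_lt.mpr (hzmin v ⟨hvt, hvr⟩)))
      (neg_lt_neg_iff.mp hw.1) (fun e => hw.2 e.symm) h'
  · exact hσ.false_of_chosen_before hconn hp.neg ht hlr.symm (neg_lt_neg hrt) hlt htl hw.1 hw.2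
      (fun v hv hvt => by_contra fun hvr => absurd hv (not_lt.mpr (hwmin v ⟨hvt, hvr⟩)))
      (neg_lt_neg hz.1) (fun e => hz.2 e.symm) h'

end Orderings

/-! ### Search outputs are neighbourhood-maximal -/

section Searches

variable {V : Type*} [Fintype V]

theorem number_inj {σ : Ordering V} {u v : V} : number σ u = number σ v ↔ u = v := by
  simp [number, Fin.val_inj]

theorem number_lt_number {σ : Ordering V} {u v : V} : number σ u < number σ v ↔ σ u < σ v := by
  rw [Fin.lt_def]
  exact Nat.succ_lt_succ_iff

theorem number_le_val {σ : Ordering V} {u v : V} : number σ u ≤ (σ v : ℕ) ↔ σ u < σ v := by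
  rw [Fin.lt_def]
  exact Nat.succ_le_iff

theorem mem_mnsLabel {G : SimpleGraph V} {s : V} {σ : Ordering V} {i j : ℕ} {w : V} :
    j ∈ mnsLabel G s σ i w ↔ (w = s ∧ j = Fintype.card V + 1) ∨
      ∃ u, number σ u = j ∧ j ≤ i ∧ σ u < σ w ∧ G.Adj u w := by
  induction i with
  | zero =>
    have hpos : ∀ u, number σ u ≠ 0 := fun u => Nat.succ_ne_zero _
    simp only [mnsLabel]
    split_ifs with h
    · simp only [Finset.mem_singleton, h, true_and, Nat.le_zero]
      refine ⟨Or.inl, ?_⟩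
      rintro (h | ⟨u, h₁, h₂, -⟩)
      · exact h
      · exact absurd (h₁.trans h₂) (hpos u)
    · simp only [Finset.notMem_empty, h, false_and, false_or, false_iff, not_exists]
      rintro u ⟨h₁, h₂, -⟩
      exact hpos u (h₁.trans (Nat.le_zero.mp h₂))
  | succ i ih =>
    simp only [mnsLabel]
    split_ifs with h
    · obtain ⟨hlt, v, hv, hvw⟩ := h
      rw [Finset.mem_insert, ih]
      constructor
      · rintro (rfl | h | ⟨u, h₁, h₂, h₃⟩)
        · exact Or.inr ⟨v, hv, le_rfl, number_lt_number.mp (hv ▸ hlt), hvw⟩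
        · exact Or.inl h
        · exact Or.inr ⟨u, h₁, by omega, h₃⟩
      · rintro (h | ⟨u, h₁, h₂, h₃⟩)
        · exact Or.inr (Or.inl h)
        · rcases h₂.lt_or_eq with h' | h'
          · exact Or.inr (Or.inr ⟨u, h₁, by omega, h₃⟩)
          · exact Or.inl h'
    · rw [ih]
      refine or_congr_right (exists_congr fun u => and_congr_right fun h₁ => ?_)
      refine ⟨fun ⟨h₂, h₃⟩ => ⟨by omega, h₃⟩, fun ⟨h₂, h₃⟩ => ⟨?_, h₃⟩⟩
      rcases h₂.lt_or_eq with h' | h'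
      · omega
      · exact absurd ⟨by rw [← h', ← h₁]; exact number_lt_number.mpr h₃.1, u, h₁.trans h', h₃.2⟩ h

theorem IsMNSOrdering.isNeighborhoodMaximal {G : SimpleGraph V} {s : V} {σ : Ordering V}
    (hσ : IsMNSOrdering G s σ) : IsNeighborhoodMaximal G σ := by
  intro a v w hav hvw haw hnav
  -- Were `v` the start, the first vertex would have had label `∅` against the label `{n + 1}` of
  -- `s`.
  have hvs : v ≠ s := by
    rintro rfl
    have hv : (σ v : ℕ) ≠ 0 := by
      rw [Fin.lt_def] at hav
      omega
    let f := σ.symm ⟨0, (Nat.zero_le _).trans_lt (σ v).isLt⟩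
    have hf : (σ f : ℕ) = 0 := by simp [f]
    have hfv : f ≠ v := fun h => hv (h ▸ hf)
    refine hσ f v (by rw [Fin.le_def]; omega) ?_
    rw [hf]
    simp [mnsLabel, hfv]
  by_contra! h
  refine hσ v w hvw.le (Finset.ssubset_iff_subset_ne.mpr ⟨fun j hj => ?_, fun heq => ?_⟩)
  · rw [mem_mnsLabel] at hj ⊢
    rcases hj with ⟨h', -⟩ | ⟨u, h₁, h₂, h₃, h₄⟩
    · exact absurd h' hvs
    · exact Or.inr ⟨u, h₁, h₂, h₃.trans hvw, h u h₃ h₄⟩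
  · have ha : number σ a ∈ mnsLabel G s σ (σ v) w :=
      mem_mnsLabel.mpr (Or.inr ⟨a, rfl, number_le_val.mpr hav, hav.trans hvw, haw⟩)
    rw [← heq, mem_mnsLabel] at ha
    rcases ha with ⟨h', -⟩ | ⟨u, h₁, -, -, h₄⟩
    · exact hvs h'
    · exact hnav (number_inj.mp h₁ ▸ h₄)

theorem IsMCSOrdering.isNeighborhoodMaximal {G : SimpleGraph V} {s : V} {σ : Ordering V}
    (hσ : IsMCSOrdering G s σ) : IsNeighborhoodMaximal G σ := by
  intro a v w hav hvw haw hnav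
  by_contra! h
  have hv : 2 ≤ number σ v := by
    have := number_lt_number.mpr hav
    have : 1 ≤ number σ a := Nat.succ_pos _
    omega
  refine absurd (hσ.2 v w hv hvw.le) (not_le.mpr (Set.ncard_lt_ncard ?_ (Set.toFinite _)))
  refine (Set.ssubset_iff_of_subset ?_).mpr ⟨a, ⟨number_le_val.mpr hav, haw⟩, fun h' => hnav h'.2⟩
  exact fun u hu => ⟨hu.1, h u (number_le_val.mp hu.1) hu.2⟩

theorem cons_le_cons_of_le {a : ℕ} {L M : List ℕ} (h : L ≤ M) : a :: L ≤ a :: M := by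
  rcases h.lt_or_eq with h | rfl
  · exact (List.cons_lt_cons_iff.mpr (Or.inr ⟨rfl, h⟩)).le
  · exact le_rfl

theorem le_of_mem_ldfsLabel {G : SimpleGraph V} {s : V} {σ : Ordering V} {i j : ℕ} {w : V}
    (h : j ∈ ldfsLabel G s σ i w) : j ≤ i := by
  induction i with
  | zero =>
    simp only [ldfsLabel] at h
    split_ifs at h <;> simp_all
  | succ i ih =>
    simp only [ldfsLabel] at h
    split_ifs at h
    · rcases List.mem_cons.mp h with h | h
      · omega
      · exact (ih h).trans (Nat.le_succ i)
    · exact (ih h).trans (Nat.le_succ i)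

theorem ldfsLabel_lt_cons {G : SimpleGraph V} {s : V} {σ : Ordering V} {i : ℕ} {w : V}
    (L : List ℕ) : ldfsLabel G s σ i w < (i + 1) :: L := by
  cases hl : ldfsLabel G s σ i w with
  | nil => exact List.nil_lt_cons _ _
  | cons j M =>
    have : j ≤ i := le_of_mem_ldfsLabel (w := w) (s := s) (σ := σ) (G := G) (by simp [hl])
    exact List.cons_lt_cons_iff.mpr (Or.inl (by omega))

theorem IsLDFSOrdering.val_start {G : SimpleGraph V} {s : V} {σ : Ordering V}
    (hσ : IsLDFSOrdering G s σ) : (σ s : ℕ) = 0 := by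
  let f := σ.symm ⟨0, (Nat.zero_le _).trans_lt (σ s).isLt⟩
  have hf : (σ f : ℕ) = 0 := by simp [f]
  have := hσ f s (by rw [Fin.le_def]; omega)
  rw [hf] at this
  by_cases hfs : f = s
  · exact hfs ▸ hf
  · simp only [ldfsLabel, hfs, if_true, if_false] at this
    exact absurd (List.nil_lt_cons 0 []) (not_lt.mpr this)

/-- The newest number is the largest and comes first, so a number given to `w` alone makes its label
strictly larger. Numbers given to both preserve the order, and by `h` none goes to `v` alone. -/
theorem ldfsLabel_le {G : SimpleGraph V} {s : V} {σ : Ordering V} {v w : V} (hv : v ≠ s)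
    (hvw : σ v < σ w) {i : ℕ} (hi : i ≤ σ v)
    (h : ∀ b, σ b < σ v → G.Adj b v → G.Adj b w) :
    ldfsLabel G s σ i v ≤ ldfsLabel G s σ i w ∧
      ((∃ a, number σ a ≤ i ∧ G.Adj a w ∧ ¬ G.Adj a v) →
        ldfsLabel G s σ i v < ldfsLabel G s σ i w) := by
  induction i with
  | zero =>
    constructor
    · simp only [ldfsLabel, hv, if_false]
      exact not_lt.mp (List.not_lt_nil _)
    · rintro ⟨a, ha, -⟩
      exact absurd ha (Nat.not_succ_le_zero _)
  | succ i ih =>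
    have ih := ih (by omega)
    have hiv : i + 1 < number σ v := by unfold number; omega
    have hiw : i + 1 < number σ w := hiv.trans (number_lt_number.mpr hvw)
    simp only [ldfsLabel]
    split_ifs with h₁ h₂ h₂
    · refine ⟨cons_le_cons_of_le ih.1, ?_⟩
      rintro ⟨a, ha, haw, hav⟩
      refine List.cons_lt_cons_iff.mpr (Or.inr ⟨rfl, ih.2 ⟨a, ?_, haw, hav⟩⟩)
      obtain ⟨-, b, hb, hbv⟩ := h₁
      rcases ha.lt_or_eq with h' | h'
      · omega
      · exact absurd (number_inj.mp (h'.trans hb.symm) ▸ hbv) hav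
    · obtain ⟨-, b, hb, hbv⟩ := h₁
      exact absurd ⟨hiw, b, hb, h b (number_lt_number.mp (hb ▸ hiv)) hbv⟩ h₂
    · exact ⟨(ldfsLabel_lt_cons _).le, fun _ => ldfsLabel_lt_cons _⟩
    · refine ⟨ih.1, ?_⟩
      rintro ⟨a, ha, haw, hav⟩
      refine ih.2 ⟨a, ?_, haw, hav⟩
      rcases ha.lt_or_eq with h' | h'
      · omega
      · exact absurd ⟨hiw, a, h', haw⟩ h₂

theorem IsLDFSOrdering.isNeighborhoodMaximal {G : SimpleGraph V} {s : V} {σ : Ordering V}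
    (hσ : IsLDFSOrdering G s σ) : IsNeighborhoodMaximal G σ := by
  intro a v w hav hvw haw hnav
  by_contra! h
  have hvs : v ≠ s := by
    rintro rfl
    have := hσ.val_start
    rw [Fin.lt_def] at hav
    omega
  exact absurd ((ldfsLabel_le hvs hvw le_rfl h).2 ⟨a, number_le_val.mpr hav, haw, hnav⟩)
    (not_lt.mpr (hσ v w hvw.le))

/-! ### Unit interval orders are search outputs -/

theorem IsUnitIntervalOrder.adj_of_adj {G : SimpleGraph V} {σ : Ordering V}
    (hσ : IsUnitIntervalOrder G σ) {u v w : V} (huv : σ u < σ v) (hvw : σ v ≤ σ w)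
    (h : G.Adj u w) : G.Adj u v := by
  rcases hvw.lt_or_eq with h' | h'
  · exact (hσ u v w huv h' h).1
  · exact σ.injective h' ▸ h

theorem IsUnitIntervalOrder.isMNSOrdering {G : SimpleGraph V} {σ : Ordering V}
    (hσ : IsUnitIntervalOrder G σ) {s : V} (hs : (σ s : ℕ) = 0) : IsMNSOrdering G s σ := by
  intro v w hvw hlt
  obtain ⟨hsub, hne⟩ := Finset.ssubset_iff_subset_ne.mp hlt
  refine hne (hsub.antisymm fun j hj => ?_)
  rw [mem_mnsLabel] at hj ⊢
  rcases hj with ⟨rfl, h⟩ | ⟨u, h₁, h₂, h₃, h₄⟩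
  · refine Or.inl ⟨σ.injective (Fin.ext ?_), h⟩
    rw [Fin.le_def] at hvw
    omega
  · have huv : σ u < σ v := number_le_val.mp (h₁ ▸ h₂)
    exact Or.inr ⟨u, h₁, h₂, huv, hσ.adj_of_adj huv hvw h₄⟩

theorem IsUnitIntervalOrder.isMCSOrdering {G : SimpleGraph V} {σ : Ordering V}
    (hσ : IsUnitIntervalOrder G σ) {s : V} (hs : (σ s : ℕ) = 0) : IsMCSOrdering G s σ := by
  refine ⟨by simp [number, hs], fun v w _ hvw => Set.ncard_le_ncard ?_ (Set.toFinite _)⟩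
  exact fun u hu => ⟨hu.1, hσ.adj_of_adj (number_le_val.mp hu.1) hvw hu.2⟩

theorem ldfsLabel_eq_nil {G : SimpleGraph V} {s : V} {σ : Ordering V} {i : ℕ} {w : V}
    (hw : w ≠ s) (h : ∀ u, number σ u ≤ i → ¬ G.Adj u w) : ldfsLabel G s σ i w = [] := by
  induction i with
  | zero => simp [ldfsLabel, hw]
  | succ i ih =>
    have hn : ¬ (i + 1 < number σ w ∧ ∃ v, number σ v = i + 1 ∧ G.Adj v w) :=
      fun ⟨_, v, hv, hvw⟩ => h v hv.le hvw
    rw [ldfsLabel, if_neg hn]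
    exact ih fun u hu => h u (hu.trans (Nat.le_succ i))

theorem IsUnitIntervalOrder.ldfsLabel_le {G : SimpleGraph V} {σ : Ordering V}
    (hσ : IsUnitIntervalOrder G σ) {s : V} {v w : V} (hw : w ≠ s)
    (hvw : σ v ≤ σ w) {i : ℕ} (hi : i ≤ σ v) :
    ldfsLabel G s σ i w ≤ ldfsLabel G s σ i v := by
  induction i with
  | zero =>
    simp only [ldfsLabel, hw, if_false]
    exact not_lt.mp (List.not_lt_nil _)
  | succ i ih =>
    have ih := ih (by omega)
    have hiv : i + 1 < number σ v := by unfold number; omega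
    have hiw : i + 1 < number σ w := by
      rw [Fin.le_def] at hvw
      unfold number
      omega
    simp only [ldfsLabel]
    split_ifs with h₁ h₂ h₂
    · exact cons_le_cons_of_le ih
    · obtain ⟨-, b, hb, hbw⟩ := h₁
      exact absurd ⟨hiv, b, hb, hσ.adj_of_adj (number_lt_number.mp (hb ▸ hiv)) hvw hbw⟩ h₂
    -- `b` sees `v` but not `w`, so no vertex before `b` sees `w` either, and the label of `w` is
    -- empty.
    · obtain ⟨-, b, hb, hbv⟩ := h₂
      rw [ldfsLabel_eq_nil hw]
      · exact not_lt.mp (List.not_lt_nil _)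
      · intro u hu huw
        exact h₁ ⟨hiw, b, hb, (hσ u b w (number_lt_number.mp (by omega))
          (number_lt_number.mp (by omega)) huw).2⟩
    · exact ih

theorem IsUnitIntervalOrder.isLDFSOrdering {G : SimpleGraph V} {σ : Ordering V}
    (hσ : IsUnitIntervalOrder G σ) {s : V} (hs : (σ s : ℕ) = 0) : IsLDFSOrdering G s σ := by
  intro v w hvw
  by_cases hw : w = s
  · have : v = w := by
      refine σ.injective (Fin.ext ?_)
      rw [Fin.le_def, hw] at hvw
      rw [hw]
      omega
    rw [this]
  · exact hσ.ldfsLabel_le hw hvw le_rfl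

end Searches

end GraphSearch

theorem mainTheorem4 {V : Type*} [Fintype V] (G : SimpleGraph V) (hconn : G.Connected)
    (hG : GraphSearch.IsUnitIntervalGraph G) :
    (∀ t : V, List.TFAE [
      GraphSearch.IsSimplicial G t ∧
        (GraphSearch.deleteSet G (GraphSearch.closedNeighborSet G t)).Preconnected,
      ∃ σ : GraphSearch.Ordering V,
        GraphSearch.IsUnitIntervalOrder G σ ∧ GraphSearch.IsLast σ t,
      GraphSearch.IsMNSEndVertex G t,
      GraphSearch.IsMCSEndVertex G t,
      GraphSearch.IsLDFSEndVertex G t]) ∧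
    {t : V | GraphSearch.IsMNSEndVertex G t} = {t : V | GraphSearch.IsMCSEndVertex G t} ∧
    {t : V | GraphSearch.IsMCSEndVertex G t} = {t : V | GraphSearch.IsLDFSEndVertex G t} := by
  obtain ⟨p, hp⟩ := hG.exists_isUmbrellaRank
  have end_vertex : ∀ (t : V) (σ : GraphSearch.Ordering V),
      GraphSearch.IsNeighborhoodMaximal G σ → GraphSearch.IsLast σ t →
      GraphSearch.IsSimplicial G t ∧
        (GraphSearch.deleteSet G (GraphSearch.closedNeighborSet G t)).Preconnected := by
    intro t σ hσ ht
    rcases hσ.isInitialTwin_or hconn hp ht with h | h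
    · exact hp.isSimplicial_and_preconnected hconn h
    · exact hp.neg.isSimplicial_and_preconnected hconn h
  have start : ∀ (t : V) (σ : GraphSearch.Ordering V), ∃ s, (σ s : ℕ) = 0 := fun t σ =>
    ⟨σ.symm ⟨0, (Nat.zero_le _).trans_lt (σ t).isLt⟩, by simp⟩
  have tfae : ∀ t : V, List.TFAE [
      GraphSearch.IsSimplicial G t ∧
        (GraphSearch.deleteSet G (GraphSearch.closedNeighborSet G t)).Preconnected,
      ∃ σ : GraphSearch.Ordering V,
        GraphSearch.IsUnitIntervalOrder G σ ∧ GraphSearch.IsLast σ t,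
      GraphSearch.IsMNSEndVertex G t,
      GraphSearch.IsMCSEndVertex G t,
      GraphSearch.IsLDFSEndVertex G t] := by
    intro t
    tfae_have 1 → 2 := by
      rintro ⟨hs, hc⟩
      rcases hp.isInitialTwin_or hs hc with h | h
      · exact hp.exists_isUnitIntervalOrder h
      · exact hp.neg.exists_isUnitIntervalOrder h
    tfae_have 2 → 3 := fun ⟨σ, hσ, ht⟩ =>
      (start t σ).imp fun _ hs => ⟨σ, hσ.isMNSOrdering hs, ht⟩
    tfae_have 2 → 4 := fun ⟨σ, hσ, ht⟩ =>
      (start t σ).imp fun _ hs => ⟨σ, hσ.isMCSOrdering hs, ht⟩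
    tfae_have 2 → 5 := fun ⟨σ, hσ, ht⟩ =>
      (start t σ).imp fun _ hs => ⟨σ, hσ.isLDFSOrdering hs, ht⟩
    tfae_have 3 → 1 := fun ⟨_, σ, hσ, ht⟩ => end_vertex t σ hσ.isNeighborhoodMaximal ht
    tfae_have 4 → 1 := fun ⟨_, σ, hσ, ht⟩ => end_vertex t σ hσ.isNeighborhoodMaximal ht
    tfae_have 5 → 1 := fun ⟨_, σ, hσ, ht⟩ => end_vertex t σ hσ.isNeighborhoodMaximal ht
    tfae_finish
  exact ⟨tfae, Set.ext fun t => (tfae t).out 2 3, Set.ext fun t => (tfae t).out 3 4⟩
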